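/- Let $G$ and $H$ be finite abelian groups, written additively. For a finite abelian group $K$ and a positive integer $m$, let $\mathsf M(K,m)$ be the set of zero-sum sequences of length $m$ over $K$, that is, of multisets of $m$ elements of $K$ (unordered, with repetition allowed and counted with multiplicity) whose sum is $0$. For a positive integer $d$, let $\varphi_K(d)$ be the number of elements of order $d$ in $K$. Then $$|\mathsf M(G,|H|)|=|\mathsf M(H,|G|)|$$ if and only if $\varphi_G(d)=\varphi_H(d)$ for every positive integer $d$ dividing $\gcd(|G|,|H|)$. -/

import Mathlib

/-- The set of zero-sum sequences of length `m` over `G`. A sequence is unordered and may repeat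
terms, so it is a multiset; its length is the cardinality counted with multiplicity. -/
def zeroSumSequences (G : Type*) [AddCommGroup G] (m : ℕ) : Set (Multiset G) :=
  {S | S.card = m ∧ S.sum = 0}

/-- Over a finite group there are only finitely many zero-sum sequences of a given length, so that
`Set.ncard` of this set is its true cardinality. -/
theorem zeroSumSequences_finite (G : Type*) [AddCommGroup G] [Finite G] (m : ℕ) :
    (zeroSumSequences G m).Finite := by
  classical
  cases nonempty_fintype G
  exact (Set.finite_range (fun s : Sym G m => (s : Multiset G))).subset
    fun S hS => ⟨⟨S, hS.1⟩, rfl⟩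

/-- The number of elements of order `d` in `G`. -/
noncomputable def numOfOrder (G : Type*) [AddCommGroup G] (d : ℕ) : ℕ :=
  {g : G | addOrderOf g = d}.ncard

/-!
Write `n = |G|`, `m = |H|`, `g = gcd (n, m)`, and `φ K d` for the number of elements of order `d`.

**Counting.** Orthogonality of the characters of `G` turns `n * |M(G, m)|` into the sum over all
characters `χ` of the coefficient of `X ^ m` in `∏ x, (1 - χ x * X)⁻¹`. A character of order `d` is
equidistributed on the `d`-th roots of unity, so that this product is `(1 - X ^ d) ^ (-(n / d))`.
As `G` is isomorphic to its dual, there are `φ G d` characters of order `d`, and one finds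
`(n + m) * |M(G, m)| = ∑ d ∣ g, φ G d * ((n + m) / d).choose (n / d)`
(`add_mul_ncard_zeroSumSequences`). The weights are symmetric in `n` and `m`, so the theorem says
that these two weighted sums agree only if the functions `φ G` and `φ H` agree on the divisors
of `g`.

**Separation.** Let `d` be the least divisor of `g` with `φ G d ≠ φ H d`, say `φ H d < φ G d`. Since
`φ G` and `φ H` are multiplicative, `d` is a power of a prime `p`. The groups have equally many
elements of each smaller order dividing `d`, and in both the number of solutions of `d • x = 0` is
divisible by `d`; hence `φ G d - φ H d ≥ d`. It remains to see that `d` times the weight at `d`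
exceeds the sum of `φ H i * ((n + m) / i).choose (n / i)` over the other `i` where `φ G` and `φ H`
differ, all of which are larger than `d`. With `n = g * a`, `m = g * b` the weight at `i` is
`scaledChoose a b (g / i)`, and three terms of Vandermonde's identity show that `scaledChoose a b`
grows at least by the factor `2 * b + 1` in each step (`two_mul_add_one_mul_scaledChoose_le`).

* For `i ≥ 2 * d` the scaling factor is at most half of `g / d`, and the trivial bound `m` for the
  number of elements suffices.
* For `d < i < 2 * d` minimality and multiplicativity force `i` to be coprime to `d`. There are at
  most `m / d` elements of `H` of such orders, because `H` contains at least `d` solutions of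
  `d • x = 0` (`ncard_nsmul_eq_zero_mul_ncard_coprime_le`). Moreover `d * i ∣ g`, which bounds
  the distance of the scaling factors `g / d` and `g / i` from below (`mul_scaledChoose_div_le`).

The two contributions together stay below `d` times the weight at `d`
(`mul_scaledChoose_half_add_lt`, `sum_numOfOrder_mul_choose_lt`).
-/

/-! ### Generating functions of characters -/

section Characters

open PowerSeries

/-- The complete homogeneous symmetric function in the values of `a`, as a coefficient of the
product of the geometric series `∑ (a i) ^ k X ^ k`. -/
theorem sum_sym_prod_map_eq_coeff {α R : Type*} [Fintype α] [DecidableEq α] [CommRing R]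
    (a : α → R) (m : ℕ) :
    ∑ s : Sym α m, ((s : Multiset α).map a).prod =
      coeff m (∏ i, (mk fun k => a i ^ k : R⟦X⟧)) := by
  rw [coeff_prod]
  simp only [coeff_mk]
  refine Finset.sum_nbij (fun s => Multiset.toFinsupp (s : Multiset α)) ?_ ?_ ?_ ?_
  · intro s _
    simp only [Finset.mem_finsuppAntidiag, Finset.subset_univ, and_true, Multiset.toFinsupp_apply]
    exact (Multiset.sum_count_eq_card fun _ _ => Finset.mem_univ _).trans s.2
  · intro s _ t _ h
    exact Subtype.ext (Multiset.toFinsupp.injective h)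
  · intro P hP
    rw [Finset.mem_coe, Finset.mem_finsuppAntidiag] at hP
    refine ⟨⟨Finsupp.toMultiset P, ?_⟩, Finset.mem_coe.2 (Finset.mem_univ _),
      Finsupp.toMultiset_toFinsupp P⟩
    rw [Finsupp.card_toMultiset, ← hP.1, Finsupp.sum_fintype _ _ (by simp)]
    rfl
  · intro s _
    simp only [Multiset.toFinsupp_apply]
    rw [Finset.prod_multiset_map_count]
    refine Finset.prod_subset (Finset.subset_univ _) fun x _ hx => ?_
    rw [Multiset.count_eq_zero.2 (by simpa using hx), pow_zero]

theorem card_range_character {A : Type*} [CommGroup A] [Finite A] (φ : A →* ℂˣ) :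
    Nat.card φ.range = orderOf φ := by
  have : Finite φ.range := Set.finite_range φ
  rw [← IsCyclic.exponent_eq_card]
  refine Nat.dvd_right_iff_eq.1 fun k => ?_
  rw [orderOf_dvd_iff_pow_eq_one, Monoid.exponent_dvd_iff_forall_pow_eq_one]
  constructor
  · intro h
    ext a
    have := h ⟨φ a, a, rfl⟩
    simpa [Subtype.ext_iff, Units.ext_iff] using this
  · rintro h ⟨_, a, rfl⟩
    have := DFunLike.congr_fun h a
    simpa [Subtype.ext_iff] using this

/-- A character of order `c` takes as values exactly the `c`-th roots of unity. -/
theorem image_character_eq_nthRootsFinset {A : Type*} [CommGroup A] [Fintype A] (φ : A →* ℂˣ) :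
    Finset.univ.image (fun a => (φ a : ℂ)) = Polynomial.nthRootsFinset (orderOf φ) (1 : ℂ) := by
  classical
  have hc : 0 < orderOf φ := orderOf_pos φ
  refine Finset.eq_of_subset_of_card_le ?_ ?_
  · intro z hz
    obtain ⟨a, -, rfl⟩ := Finset.mem_image.1 hz
    rw [Polynomial.mem_nthRootsFinset hc]
    have := congrArg Units.val (DFunLike.congr_fun (pow_orderOf_eq_one φ) a)
    rwa [MonoidHom.pow_apply, Units.val_pow_eq_pow_val] at this
  · rw [(Complex.isPrimitiveRoot_exp _ hc.ne').card_nthRootsFinset, ← card_range_character φ]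
    have h : (Finset.univ.image (fun a => (φ a : ℂ))) =
        (Finset.univ.image φ).image (fun u : ℂˣ => (u : ℂ)) := by
      rw [Finset.image_image]; rfl
    rw [h, Finset.card_image_of_injective _ Units.val_injective, ← Set.ncard_coe_finset,
      Finset.coe_image, Finset.coe_univ, Set.image_univ, ← MonoidHom.coe_range]
    exact le_rfl

theorem one_sub_X_pow_eq_prod {c : ℕ} (hc : 0 < c) :
    (1 - X ^ c : ℂ⟦X⟧) = ∏ z ∈ Polynomial.nthRootsFinset c (1 : ℂ), (1 - C z * X) := by
  classical
  have hz := Complex.isPrimitiveRoot_exp _ hc.ne'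
  have hC := hz.map_of_injective (C_injective (R := ℂ))
  have h := hC.pow_sub_pow_eq_prod_sub_mul 1 X hc
  rw [one_pow] at h
  rw [h]
  have him : Polynomial.nthRootsFinset c (1 : ℂ⟦X⟧) =
      (Polynomial.nthRootsFinset c (1 : ℂ)).image (C (R := ℂ)) := by
    symm
    refine Finset.eq_of_subset_of_card_le ?_ ?_
    · intro z hz
      obtain ⟨a, ha, rfl⟩ := Finset.mem_image.1 hz
      rw [Polynomial.mem_nthRootsFinset hc] at ha ⊢
      rw [← map_pow, ha, map_one]
    · rw [Finset.card_image_of_injective _ C_injective, hC.card_nthRootsFinset,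
        hz.card_nthRootsFinset]
  rw [him, Finset.prod_image (fun _ _ _ _ h => C_injective h)]

/-- The values of a character of order `c` are equidistributed on the `c`-th roots of unity. -/
theorem prod_one_sub_character {A : Type*} [CommGroup A] [Fintype A] (φ : A →* ℂˣ) :
    ∏ a, (1 - C (φ a : ℂ) * X : ℂ⟦X⟧) = (1 - X ^ orderOf φ) ^ (Nat.card A / orderOf φ) := by
  classical
  have hc : 0 < orderOf φ := orderOf_pos φ
  have hcard : (Polynomial.nthRootsFinset (orderOf φ) (1 : ℂ)).card = orderOf φ :=
    (Complex.isPrimitiveRoot_exp _ hc.ne').card_nthRootsFinset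
  have hfib : ∀ z ∈ Polynomial.nthRootsFinset (orderOf φ) (1 : ℂ),
      (Finset.univ.filter fun a => (φ a : ℂ) = z).card =
        (Finset.univ.filter fun a => (φ a : ℂ) = 1).card := by
    intro z hz
    rw [← image_character_eq_nthRootsFinset] at hz
    obtain ⟨a, -, rfl⟩ := Finset.mem_image.1 hz
    have := MonoidHom.card_fiber_eq_of_mem_range ((Units.coeHom ℂ).comp φ)
      (x := (φ a : ℂ)) (y := 1) ⟨a, rfl⟩ ⟨1, by simp⟩
    exact this
  have htot : Nat.card A =
      orderOf φ * (Finset.univ.filter fun a => (φ a : ℂ) = 1).card := by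
    rw [Nat.card_eq_fintype_card, ← Finset.card_univ,
      Finset.card_eq_sum_card_image (fun a => (φ a : ℂ)), image_character_eq_nthRootsFinset,
      Finset.sum_congr rfl hfib, Finset.sum_const, hcard, smul_eq_mul]
  rw [Finset.prod_comp (fun z : ℂ => (1 - C z * X : ℂ⟦X⟧)) (fun a => (φ a : ℂ)),
    image_character_eq_nthRootsFinset, one_sub_X_pow_eq_prod hc, ← Finset.prod_pow]
  refine Finset.prod_congr rfl fun z hz => ?_
  rw [hfib z hz, htot, Nat.mul_div_cancel_left _ hc]

theorem mk_pow_mul_one_sub {R : Type*} [CommRing R] (z : R) :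
    (mk fun k => z ^ k : R⟦X⟧) * (1 - C z * X) = 1 := by
  ext k
  rw [mul_sub, mul_one, mul_left_comm, ← mul_assoc]
  cases k with
  | zero => simp
  | succ k => simp [coeff_succ_mul_X, coeff_one, pow_succ', mul_assoc]

theorem orderOf_character_dvd_card {A : Type*} [CommGroup A] [Finite A] (φ : A →* ℂˣ) :
    orderOf φ ∣ Nat.card A := by
  rw [orderOf_dvd_iff_pow_eq_one]
  ext a
  simp [← map_pow]

/-- The values of a character of order `c` at the products of the multisets of cardinality `m` add
up to the coefficient of `X ^ m` in `(1 - X ^ c) ^ (-(|A| / c))`. -/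
theorem sum_sym_character {A : Type*} [CommGroup A] [Fintype A] [DecidableEq A]
    (φ : A →* ℂˣ) (m : ℕ) :
    ∑ s : Sym A m, (φ (s : Multiset A).prod : ℂ) =
      if orderOf φ ∣ m then (((Nat.card A / orderOf φ - 1 + m / orderOf φ).choose
        (Nat.card A / orderOf φ - 1) : ℕ) : ℂ) else 0 := by
  have hc : 0 < orderOf φ := orderOf_pos φ
  have hpos : 0 < Nat.card A / orderOf φ :=
    Nat.div_pos (Nat.le_of_dvd Nat.card_pos (orderOf_character_dvd_card φ)) hc
  have h1 : ∀ s : Sym A m, (φ (s : Multiset A).prod : ℂ) =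
      ((s : Multiset A).map fun a => (φ a : ℂ)).prod := by
    intro s
    have := map_multiset_prod ((Units.coeHom ℂ).comp φ) (s : Multiset A)
    exact this
  rw [Finset.sum_congr rfl fun s _ => h1 s, sum_sym_prod_map_eq_coeff]
  have h2 : (∏ a, (mk fun k => (φ a : ℂ) ^ k : ℂ⟦X⟧)) *
      (1 - X ^ orderOf φ) ^ (Nat.card A / orderOf φ) = 1 := by
    rw [← prod_one_sub_character, ← Finset.prod_mul_distrib]
    exact Finset.prod_eq_one fun a _ => mk_pow_mul_one_sub _
  have h3 : expand (orderOf φ) hc.ne' (invOneSubPow ℂ (Nat.card A / orderOf φ)).val *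
      (1 - X ^ orderOf φ) ^ (Nat.card A / orderOf φ) = 1 := by
    have := (invOneSubPow ℂ (Nat.card A / orderOf φ)).val_inv
    rw [invOneSubPow_inv_eq_one_sub_pow] at this
    have := congrArg (expand (orderOf φ) hc.ne') this
    simpa using this
  have h4 : (∏ a, (mk fun k => (φ a : ℂ) ^ k : ℂ⟦X⟧)) =
      expand (orderOf φ) hc.ne' (invOneSubPow ℂ (Nat.card A / orderOf φ)).val := by
    have h5 := (IsUnit.of_mul_eq_one_right _ h3).mul_right_cancel (h2.trans h3.symm)
    exact h5
  rw [h4, coeff_expand, invOneSubPow_val_eq_mk_sub_one_add_choose_of_pos _ _ hpos, coeff_mk]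

theorem sum_character_apply {A : Type*} [CommGroup A] [Finite A] [Fintype (A →* ℂˣ)]
    [DecidableEq A] (a : A) :
    ∑ φ : A →* ℂˣ, (φ a : ℂ) = if a = 1 then (Nat.card A : ℂ) else 0 := by
  split_ifs with h
  · subst h
    simp [← CommGroup.card_monoidHom_of_hasEnoughRootsOfUnity A ℂ]
  · obtain ⟨ψ, hψ⟩ := CommGroup.exists_apply_ne_one_of_hasEnoughRootsOfUnity A ℂ h
    have h1 : (ψ a : ℂ) * ∑ φ : A →* ℂˣ, (φ a : ℂ) = ∑ φ : A →* ℂˣ, (φ a : ℂ) := by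
      rw [Finset.mul_sum]
      exact Fintype.sum_equiv (Equiv.mulLeft ψ) _ _ fun φ => by simp
    have h2 : ((ψ a : ℂ) - 1) * ∑ φ : A →* ℂˣ, (φ a : ℂ) = 0 := by rw [sub_mul, h1]; ring
    refine (mul_eq_zero.1 h2).resolve_left fun h3 => hψ ?_
    exact Units.ext (by simpa using sub_eq_zero.1 h3)

end Characters

/-! ### The number of zero-sum sequences -/

section Counting

variable {G : Type*} [AddCommGroup G]

theorem numOfOrder_eq_card_filter [Fintype G] (d : ℕ) :
    numOfOrder G d = (Finset.univ.filter fun g : G => addOrderOf g = d).card := by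
  rw [numOfOrder, ← Set.ncard_coe_finset]
  simp

theorem ncard_zeroSumSequences_eq_card_filter [Fintype (Multiplicative G)]
    [DecidableEq (Multiplicative G)] (m : ℕ) :
    (zeroSumSequences G m).ncard = (Finset.univ.filter fun s : Sym (Multiplicative G) m =>
      (s : Multiset (Multiplicative G)).prod = 1).card := by
  rw [← Set.ncard_coe_finset]
  have hsum : ∀ S : Multiset (Multiplicative G),
      (S.map Multiplicative.toAdd).sum = Multiplicative.toAdd S.prod := fun S =>
    Multiset.induction_on S rfl fun a S ih => by
      rw [Multiset.map_cons, Multiset.sum_cons, Multiset.prod_cons, ih, toAdd_mul]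
  refine (Set.ncard_congr (fun (s : Sym (Multiplicative G) m) _ =>
    (s : Multiset (Multiplicative G)).map Multiplicative.toAdd) ?_ ?_ ?_).symm
  · intro s hs
    have hs' : (s : Multiset (Multiplicative G)).prod = 1 := by simpa using hs
    exact ⟨(Multiset.card_map _ _).trans s.2, by rw [hsum, hs', toAdd_one]⟩
  · intro s t _ _ h
    exact Subtype.ext (Multiset.map_injective Multiplicative.toAdd.injective h)
  · rintro S ⟨h1, h2⟩
    have hS : (S.map Multiplicative.ofAdd).map Multiplicative.toAdd = S := by simp
    refine ⟨⟨S.map Multiplicative.ofAdd, (Multiset.card_map _ _).trans h1⟩, ?_, hS⟩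
    have h3 := hsum (S.map Multiplicative.ofAdd)
    rw [hS, h2] at h3
    exact Finset.mem_coe.2 (Finset.mem_filter.2 ⟨Finset.mem_univ _, toAdd_eq_zero.1 h3.symm⟩)

theorem sum_character_sum_sym {A : Type*} [CommGroup A] [Fintype A] [DecidableEq A]
    [Fintype (A →* ℂˣ)] (m : ℕ) :
    ∑ φ : A →* ℂˣ, ∑ s : Sym A m, (φ (s : Multiset A).prod : ℂ) =
      Nat.card A * (Finset.univ.filter fun s : Sym A m => (s : Multiset A).prod = 1).card := by
  rw [Finset.sum_comm]
  simp only [sum_character_apply]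
  rw [← Finset.sum_filter, Finset.sum_const, nsmul_eq_mul, mul_comm]

theorem sum_addOrderOf [Finite G] [Fintype G] {R : Type*} [CommSemiring R] (F : ℕ → R) :
    ∑ g : G, F (addOrderOf g) = ∑ d ∈ (Nat.card G).divisors, (numOfOrder G d : R) * F d := by
  rw [← Finset.sum_fiberwise_of_maps_to (s := Finset.univ) (t := (Nat.card G).divisors)
    (g := fun g : G => addOrderOf g)
    (fun g _ => Nat.mem_divisors.2 ⟨addOrderOf_dvd_natCard g, Nat.card_pos.ne'⟩)]
  refine Finset.sum_congr rfl fun d _ => ?_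
  rw [numOfOrder_eq_card_filter, ← nsmul_eq_mul, ← Finset.sum_const]
  exact Finset.sum_congr rfl fun g hg => by rw [(Finset.mem_filter.1 hg).2]

/-- Summing over the dual group isolates the sequences with sum `0`, and the dual group has as many
elements of each order as `G`. -/
theorem card_mul_ncard_zeroSumSequences [Finite G] (m : ℕ) :
    Nat.card G * (zeroSumSequences G m).ncard =
      ∑ d ∈ (Nat.gcd (Nat.card G) m).divisors, numOfOrder G d *
        (Nat.card G / d - 1 + m / d).choose (Nat.card G / d - 1) := by
  classical
  cases nonempty_fintype G
  have := Fintype.ofFinite (Multiplicative G →* ℂˣ)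
  obtain ⟨e⟩ := CommGroup.monoidHom_mulEquiv_of_hasEnoughRootsOfUnity (Multiplicative G) ℂ
  set F : ℕ → ℂ := fun d => if d ∣ m then
    (((Nat.card G / d - 1 + m / d).choose (Nat.card G / d - 1) : ℕ) : ℂ) else 0 with hF
  have h1 : ∑ φ : Multiplicative G →* ℂˣ, ∑ s : Sym (Multiplicative G) m,
      (φ (s : Multiset (Multiplicative G)).prod : ℂ) = ∑ g : G, F (addOrderOf g) := by
    refine Fintype.sum_equiv (e.toEquiv.trans Multiplicative.toAdd) _ _ fun φ => ?_
    rw [sum_sym_character]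
    have : addOrderOf ((e.toEquiv.trans Multiplicative.toAdd) φ) = orderOf φ := by
      rw [← e.orderOf_eq φ]
      rfl
    rw [this]
    rfl
  have h2 : ∑ φ : Multiplicative G →* ℂˣ, ∑ s : Sym (Multiplicative G) m,
      (φ (s : Multiset (Multiplicative G)).prod : ℂ) =
        Nat.card G * (zeroSumSequences G m).ncard := by
    rw [sum_character_sum_sym, ncard_zeroSumSequences_eq_card_filter,
      Nat.card_congr Multiplicative.toAdd]
  rw [h2, sum_addOrderOf] at h1
  have h3 : ∑ d ∈ (Nat.card G).divisors, (numOfOrder G d : ℂ) * F d =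
      ∑ d ∈ (Nat.gcd (Nat.card G) m).divisors, (numOfOrder G d : ℂ) * F d := by
    symm
    refine Finset.sum_subset
      (Nat.divisors_subset_of_dvd Nat.card_pos.ne' (Nat.gcd_dvd_left _ _)) fun d hd hd' => ?_
    have : ¬ d ∣ m := fun h => hd' (Nat.mem_divisors.2
      ⟨Nat.dvd_gcd (Nat.dvd_of_mem_divisors hd) h, (Nat.gcd_pos_of_pos_left _ Nat.card_pos).ne'⟩)
    simp [hF, this]
  rw [h3] at h1
  have h4 : ∑ d ∈ (Nat.gcd (Nat.card G) m).divisors, (numOfOrder G d : ℂ) * F d =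
      ((∑ d ∈ (Nat.gcd (Nat.card G) m).divisors, numOfOrder G d *
        (Nat.card G / d - 1 + m / d).choose (Nat.card G / d - 1) : ℕ) : ℂ) := by
    rw [Nat.cast_sum]
    refine Finset.sum_congr rfl fun d hd => ?_
    have : d ∣ m := (Nat.dvd_of_mem_divisors hd).trans (Nat.gcd_dvd_right _ _)
    simp [hF, this]
  rw [h4] at h1
  exact_mod_cast h1

/-- The symmetric form of the count: the right-hand side depends on `G` only through the number of
elements of each order dividing `Nat.gcd (Nat.card G) m`. -/
theorem add_mul_ncard_zeroSumSequences [Finite G] (m : ℕ) :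
    (Nat.card G + m) * (zeroSumSequences G m).ncard =
      ∑ d ∈ (Nat.gcd (Nat.card G) m).divisors, numOfOrder G d *
        ((Nat.card G + m) / d).choose (Nat.card G / d) := by
  refine Nat.eq_of_mul_eq_mul_left (Nat.card_pos (α := G)) ?_
  rw [mul_left_comm, card_mul_ncard_zeroSumSequences, Finset.mul_sum, Finset.mul_sum]
  refine Finset.sum_congr rfl fun d hd => ?_
  have hd' := Nat.dvd_of_mem_divisors hd
  obtain ⟨a, ha⟩ := hd'.trans (Nat.gcd_dvd_left _ _)
  obtain ⟨b, hb⟩ := hd'.trans (Nat.gcd_dvd_right _ _)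
  have hn : 0 < Nat.card G := Nat.card_pos
  have hd0 : 0 < d := Nat.pos_of_ne_zero fun h => hn.ne' (by rw [ha, h, zero_mul])
  have ha0 : 0 < a := Nat.pos_of_ne_zero fun h => hn.ne' (by rw [ha, h, mul_zero])
  rw [ha, hb, ← mul_add, Nat.mul_div_cancel_left _ hd0, Nat.mul_div_cancel_left _ hd0,
    Nat.mul_div_cancel_left _ hd0]
  obtain ⟨a, rfl⟩ := Nat.exists_eq_add_one.2 ha0
  have h := Nat.add_one_mul_choose_eq (a + b) a
  rw [Nat.add_sub_cancel, show a + 1 + b = a + b + 1 by ring]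
  linear_combination (d * numOfOrder G d) * h

end Counting

/-! ### Elements of given order -/

section Orders

variable {G : Type*} [AddCommGroup G]

theorem numOfOrder_mul_of_coprime [Finite G] {a b : ℕ} (hab : a.Coprime b) (ha : 0 < a)
    (hb : 0 < b) :
    numOfOrder G (a * b) = numOfOrder G a * numOfOrder G b := by
  rw [numOfOrder, numOfOrder, numOfOrder, ← Set.ncard_prod]
  symm
  refine Set.ncard_congr (fun x _ => x.1 + x.2) ?_ ?_ ?_
  · rintro ⟨x, y⟩ ⟨rfl, rfl⟩
    exact (AddCommute.all x y).addOrderOf_add_eq_mul_addOrderOf_of_coprime hab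
  · rintro ⟨x, y⟩ ⟨x', y'⟩ ⟨hx, hy⟩ ⟨hx', hy'⟩ h
    simp only [Set.mem_ofPred_eq] at hx hy hx' hy' h
    have h1 : x - x' = y' - y := by rw [sub_eq_sub_iff_add_eq_add, h, add_comm]
    have h2 : addOrderOf (x - x') ∣ a := by
      rw [addOrderOf_dvd_iff_nsmul_eq_zero, nsmul_sub,
        addOrderOf_dvd_iff_nsmul_eq_zero.1 hx.dvd, addOrderOf_dvd_iff_nsmul_eq_zero.1 hx'.dvd,
        sub_zero]
    have h3 : addOrderOf (x - x') ∣ b := by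
      rw [h1, addOrderOf_dvd_iff_nsmul_eq_zero, nsmul_sub,
        addOrderOf_dvd_iff_nsmul_eq_zero.1 hy.dvd, addOrderOf_dvd_iff_nsmul_eq_zero.1 hy'.dvd,
        sub_zero]
    have h4 : x - x' = 0 := AddMonoid.addOrderOf_eq_one_iff.1 (Nat.eq_one_of_dvd_coprimes hab h2 h3)
    rw [h4] at h1
    rw [sub_eq_zero.1 h4, sub_eq_zero.1 h1.symm]
  · intro z hz
    have hz : addOrderOf z = a * b := hz
    have h0 : (b * Nat.gcdB a b + a * Nat.gcdA a b : ℤ) = 1 := by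
      rw [add_comm, ← Nat.gcd_eq_gcd_ab, hab.gcd_eq_one, Nat.cast_one]
    set x := (b * Nat.gcdB a b : ℤ) • z
    set y := (a * Nat.gcdA a b : ℤ) • z
    have hxy : x + y = z := by rw [← add_zsmul, h0, one_zsmul]
    have hx : addOrderOf x ∣ a := by
      rw [addOrderOf_dvd_iff_nsmul_eq_zero, ← natCast_zsmul, ← mul_zsmul,
        ← addOrderOf_dvd_iff_zsmul_eq_zero, hz]
      exact ⟨Nat.gcdB a b, by push_cast; ring⟩
    have hy : addOrderOf y ∣ b := by
      rw [addOrderOf_dvd_iff_nsmul_eq_zero, ← natCast_zsmul, ← mul_zsmul,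
        ← addOrderOf_dvd_iff_zsmul_eq_zero, hz]
      exact ⟨Nat.gcdA a b, by push_cast; ring⟩
    have h := (AddCommute.all x y).addOrderOf_add_eq_mul_addOrderOf_of_coprime
      (Nat.Coprime.of_dvd hx hy hab)
    rw [hxy, hz] at h
    have h1 := Nat.le_of_dvd ha hx
    have h2 := Nat.le_of_dvd hb hy
    refine ⟨(x, y), ⟨?_, ?_⟩, hxy⟩
    · refine le_antisymm h1 (Nat.le_of_mul_le_mul_right (c := b) ?_ hb)
      rw [h]
      exact Nat.mul_le_mul_left _ h2
    · refine le_antisymm h2 (Nat.le_of_mul_le_mul_left (c := a) ?_ ha)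
      rw [h]
      exact Nat.mul_le_mul_right _ h1

theorem sum_numOfOrder_eq_ncard [Finite G] (D : Finset ℕ) :
    ∑ d ∈ D, numOfOrder G d = {g : G | addOrderOf g ∈ D}.ncard := by
  classical
  cases nonempty_fintype G
  have h : {g : G | addOrderOf g ∈ D} =
      ((Finset.univ.filter fun g : G => addOrderOf g ∈ D : Finset G) : Set G) := by simp
  rw [h, Set.ncard_coe_finset, Finset.card_eq_sum_card_fiberwise
    (s := Finset.univ.filter fun g : G => addOrderOf g ∈ D) (f := addOrderOf) (t := D)
    (fun g hg => (Finset.mem_filter.1 (Finset.mem_coe.1 hg)).2)]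
  refine Finset.sum_congr rfl fun d hd => ?_
  rw [numOfOrder, ← Set.ncard_coe_finset]
  congr 1
  ext g
  simp only [Set.mem_ofPred_eq, Finset.coe_filter, Finset.mem_filter, Finset.mem_univ, true_and]
  exact ⟨fun h => ⟨h ▸ hd, h⟩, fun h => h.2⟩

theorem sum_numOfOrder_divisors [Finite G] {d : ℕ} (hd : 0 < d) :
    ∑ i ∈ d.divisors, numOfOrder G i = {g : G | d • g = 0}.ncard := by
  rw [sum_numOfOrder_eq_ncard]
  congr 1
  ext g
  simp [addOrderOf_dvd_iff_nsmul_eq_zero, hd.ne']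

/-- The `p ^ k`-torsion is a `p`-group, and it contains a subgroup of order `p ^ k`. -/
theorem pow_dvd_ncard_nsmul_eq_zero [Finite G] {p k : ℕ} (hp : p.Prime) (h : p ^ k ∣ Nat.card G) :
    p ^ k ∣ {g : G | p ^ k • g = 0}.ncard := by
  have := Fact.mk hp
  let T : AddSubgroup G := (nsmulAddMonoidHom (α := G) (p ^ k)).ker
  have hT : {g : G | p ^ k • g = 0} = (T : Set G) := rfl
  rw [hT, ← Nat.card_coe_set_eq]
  change _ ∣ Nat.card T
  have hpg : IsPGroup p (Multiplicative T) := by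
    intro t
    refine ⟨k, ?_⟩
    have h1 : p ^ k • Multiplicative.toAdd t = 0 := Subtype.ext (Multiplicative.toAdd t).2
    exact h1
  obtain ⟨n, hn⟩ := IsPGroup.iff_card.1 hpg
  obtain ⟨K, hK⟩ := Sylow.exists_subgroup_card_pow_prime (G := Multiplicative G) p (n := k) h
  have hle : p ^ k ≤ Nat.card T := by
    rw [← hK]
    refine Nat.card_le_card_of_injective
      (fun x : K => (⟨Multiplicative.toAdd (x : Multiplicative G), ?_⟩ : T)) ?_
    · have h1 : x ^ p ^ k = 1 := by rw [← hK]; exact pow_card_eq_one'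
      have h2 : (x : Multiplicative G) ^ p ^ k = 1 := congrArg Subtype.val h1
      exact h2
    · intro x y hxy
      have h1 := congrArg (fun t : T => (t : G)) hxy
      exact Subtype.ext h1
  have hn' : Nat.card T = p ^ n := hn
  rw [hn'] at hle ⊢
  exact Nat.pow_dvd_pow p ((Nat.pow_le_pow_iff_right hp.one_lt).1 hle)

/-- Elements of order coprime to `d` meet the `d`-torsion trivially, so their numbers multiply to at
most the order of the group. -/
theorem ncard_nsmul_eq_zero_mul_ncard_coprime_le [Finite G] (d : ℕ) :
    {g : G | d • g = 0}.ncard * {g : G | (addOrderOf g).Coprime d}.ncard ≤ Nat.card G := by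
  rw [← Set.ncard_prod, ← Set.ncard_univ]
  refine Set.ncard_le_ncard_of_injOn (fun x => x.1 + x.2) (fun _ _ => Set.mem_univ _) ?_
  rintro ⟨x, y⟩ ⟨hx, hy⟩ ⟨x', y'⟩ ⟨hx', hy'⟩ h
  simp only [Set.mem_ofPred_eq] at hx hy hx' hy' h
  have h1 : x - x' = y' - y := by rw [sub_eq_sub_iff_add_eq_add, h, add_comm]
  have h2 : addOrderOf (x - x') ∣ d := by
    rw [addOrderOf_dvd_iff_nsmul_eq_zero, nsmul_sub, hx, hx', sub_zero]
  have h3 : addOrderOf (x - x') ∣ addOrderOf y' * addOrderOf y := by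
    rw [h1, addOrderOf_dvd_iff_nsmul_eq_zero, nsmul_sub, mul_nsmul, addOrderOf_nsmul_eq_zero,
      mul_comm, mul_nsmul, addOrderOf_nsmul_eq_zero]
    simp
  have h4 : x - x' = 0 := AddMonoid.addOrderOf_eq_one_iff.1
    (Nat.eq_one_of_dvd_coprimes (hy'.mul_left hy) h3 h2)
  rw [h4] at h1
  rw [sub_eq_zero.1 h4, sub_eq_zero.1 h1.symm]

end Orders

/-! ### Growth of the binomial coefficients -/

section Growth

/-- The binomial coefficient with entries `e * (a + b)` and `e * a`, seen as a function of the
scaling factor `e`. For `a = |G| / g`, `b = |H| / g` with `g = gcd (|G|, |H|)` it is the weight of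
the elements of order `g / e` in the count of zero-sum sequences. -/
def scaledChoose (a b e : ℕ) : ℕ := (e * (a + b)).choose (e * a)

theorem add_one_le_choose {a b : ℕ} (ha : 0 < a) : b + 1 ≤ (a + b).choose a := by
  calc b + 1 = (b + 1).choose b := (Nat.choose_succ_self_right b).symm
    _ ≤ (a + b).choose b := Nat.choose_le_choose b (by omega)
    _ = (a + b).choose a := Nat.choose_symm_add.symm

/-- The growth estimate: three central terms of Vandermonde's identity. -/
theorem two_mul_add_one_mul_scaledChoose_le {a b e : ℕ} (ha : 0 < a) (hb : 0 < b) (he : 0 < e) :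
    (2 * b + 1) * scaledChoose a b e ≤ scaledChoose a b (e + 1) := by
  rw [scaledChoose, scaledChoose]
  have hea : 0 < e * a := Nat.mul_pos he ha
  have heb : 0 < e * b := Nat.mul_pos he hb
  obtain ⟨x, hx⟩ := Nat.exists_eq_add_one.2 hea
  obtain ⟨y, rfl⟩ := Nat.exists_eq_add_one.2 ha
  have hvan : (e * (y + 1 + b)).choose (x + 1) * (y + 1 + b).choose (y + 1) +
      ((e * (y + 1 + b)).choose (x + 2) * (y + 1 + b).choose y +
       (e * (y + 1 + b)).choose x * (y + 1 + b).choose (y + 2)) ≤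
      ((e + 1) * (y + 1 + b)).choose ((e + 1) * (y + 1)) := by
    rw [add_one_mul, add_one_mul, hx, Nat.add_choose_eq (e * (y + 1 + b))]
    have hsub : ({(x + 1, y + 1), (x + 2, y), (x, y + 2)} : Finset (ℕ × ℕ)) ⊆
        Finset.HasAntidiagonal.antidiagonal (x + 1 + (y + 1)) := by
      intro z hz
      simp only [Finset.mem_insert, Finset.mem_singleton] at hz
      rw [Finset.HasAntidiagonal.mem_antidiagonal]
      rcases hz with rfl | rfl | rfl <;> simp only <;> omega
    refine le_trans (le_of_eq ?_) (Finset.sum_le_sum_of_subset hsub)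
    rw [Finset.sum_insert (by simp), Finset.sum_insert (by simp), Finset.sum_singleton]
  have hN : e * (y + 1 + b) = x + 1 + e * b := by rw [← hx]; ring
  have r1 := Nat.choose_succ_right_eq (e * (y + 1 + b)) (x + 1)
  have r2 := Nat.choose_succ_right_eq (e * (y + 1 + b)) x
  have r3 := Nat.choose_succ_right_eq (y + 1 + b) y
  have r4 := Nat.choose_succ_right_eq (y + 1 + b) (y + 1)
  rw [show e * (y + 1 + b) - (x + 1) = e * b by omega] at r1
  rw [show e * (y + 1 + b) - x = e * b + 1 by omega] at r2
  rw [show y + 1 + b - y = b + 1 by omega] at r3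
  rw [show y + 1 + b - (y + 1) = b by omega] at r4
  have hc : b + 1 ≤ (y + 1 + b).choose (y + 1) := add_one_le_choose ha
  refine le_trans ?_ hvan
  rw [hx]
  generalize (e * (y + 1 + b)).choose (x + 1) = X at *
  generalize (e * (y + 1 + b)).choose (x + 2) = X2 at *
  generalize (e * (y + 1 + b)).choose x = X0 at *
  generalize (y + 1 + b).choose (y + 1) = c at *
  generalize (y + 1 + b).choose (y + 2) = c2 at *
  generalize (y + 1 + b).choose y = c0 at *
  have t1 : X * c * b ≤ 2 * (b + 1) * (X2 * c0) := by
    refine Nat.le_of_mul_le_mul_right (c := x + 1 + 1) ?_ (by omega)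
    calc X * c * b * (x + 1 + 1) ≤ X * c * b * (2 * (e * (y + 1))) :=
          Nat.mul_le_mul_left _ (by omega)
      _ = 2 * (X2 * (x + 1 + 1)) * (c0 * (b + 1)) := by rw [r1, ← r3]; ring
      _ = _ := by ring
  have t2 : X * c * b ≤ 2 * (b + 1) * (X0 * c2) := by
    refine Nat.le_of_mul_le_mul_right (c := (e * b + 1) * (y + 1 + 1)) ?_ (by positivity)
    calc X * c * b * ((e * b + 1) * (y + 1 + 1))
        ≤ X * c * b * ((e * (b + 1)) * (2 * (y + 1))) :=
          Nat.mul_le_mul_left _ (Nat.mul_le_mul (by rw [mul_add]; omega) (by omega))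
      _ = X * (x + 1) * (2 * (b + 1)) * (c * b) := by rw [← hx]; ring
      _ = _ := by rw [r2, ← r4]; ring
  refine Nat.le_of_mul_le_mul_left (c := b + 1) ?_ (by omega)
  calc (b + 1) * ((2 * b + 1) * X) = (2 * b + 1) * X * (b + 1) := by ring
    _ ≤ (2 * b + 1) * X * c := Nat.mul_le_mul_left _ hc
    _ ≤ _ := by linarith

theorem pow_mul_scaledChoose_le {a b e : ℕ} (ha : 0 < a) (hb : 0 < b) (he : 0 < e) (k : ℕ) :
    (2 * b + 1) ^ k * scaledChoose a b e ≤ scaledChoose a b (e + k) := by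
  induction k with
  | zero => simp
  | succ k ih =>
    calc (2 * b + 1) ^ (k + 1) * scaledChoose a b e
        = (2 * b + 1) * ((2 * b + 1) ^ k * scaledChoose a b e) := by ring
      _ ≤ (2 * b + 1) * scaledChoose a b (e + k) := Nat.mul_le_mul_left _ ih
      _ ≤ _ := two_mul_add_one_mul_scaledChoose_le ha hb (by omega)

theorem scaledChoose_pos {a b e : ℕ} : 0 < scaledChoose a b e :=
  Nat.choose_pos (Nat.mul_le_mul_left _ (Nat.le_add_right _ _))

theorem scaledChoose_mono {a b : ℕ} (ha : 0 < a) (hb : 0 < b) : Monotone (scaledChoose a b) := by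
  refine monotone_nat_of_le_succ fun e => ?_
  rcases Nat.eq_zero_or_pos e with rfl | he
  · simpa [scaledChoose] using Nat.succ_le_of_lt (scaledChoose_pos (a := a) (b := b) (e := 1))
  · exact (Nat.le_mul_of_pos_left _ (by omega)).trans
      (two_mul_add_one_mul_scaledChoose_le ha hb he)

/-- The weight at `e` dominates, with the trivial bound for the number of elements, all weights at
factors up to `e / 2`. -/
theorem mul_scaledChoose_half_lt {a b e : ℕ} (ha : 0 < a) (hb : 0 < b) (he : 0 < e) :
    e * b * scaledChoose a b (e / 2) < scaledChoose a b e := by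
  rcases Nat.lt_or_ge e 2 with h | h
  · obtain rfl : e = 1 := by omega
    have := add_one_le_choose (b := b) ha
    simpa [scaledChoose] using this
  · obtain ⟨k, hk⟩ : ∃ k, e = e / 2 + (k + 1) := ⟨e - e / 2 - 1, by omega⟩
    have h1 := pow_mul_scaledChoose_le ha hb (show 0 < e / 2 by omega) (k + 1)
    rw [← hk] at h1
    refine lt_of_lt_of_le (Nat.mul_lt_mul_of_pos_right ?_ scaledChoose_pos) h1
    have h3 : k + 1 ≤ (2 * b + 1) ^ k := Nat.lt_pow_self (by omega)
    calc e * b ≤ (2 * (k + 1)) * b := Nat.mul_le_mul_right _ (by omega)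
      _ < (k + 1) * (2 * b + 1) := by nlinarith
      _ ≤ (2 * b + 1) ^ k * (2 * b + 1) := Nat.mul_le_mul_right _ h3
      _ = _ := (pow_succ _ _).symm

/-- The weight at `e ≥ 3` dominates the sum of the two estimates, for the factors up to `e / 2` and
for those strictly between `e / 2` and `e`. -/
theorem mul_scaledChoose_half_add_lt {a b e : ℕ} (ha : 0 < a) (hb : 0 < b) (he : 3 ≤ e) :
    2 * (e * b * scaledChoose a b (e / 2)) + 3 * b * scaledChoose a b (e - 1) <
      2 * scaledChoose a b e := by
  obtain ⟨k, hk⟩ : ∃ k, e = e / 2 + (k + 2) := ⟨e - e / 2 - 2, by omega⟩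
  have h1 := pow_mul_scaledChoose_le ha hb (show 0 < e / 2 by omega) (k + 1)
  rw [show e / 2 + (k + 1) = e - 1 by omega] at h1
  have h2 := two_mul_add_one_mul_scaledChoose_le ha hb (show 0 < e - 1 by omega)
  rw [show e - 1 + 1 = e by omega] at h2
  have h3 : k + 1 ≤ (2 * b + 1) ^ k := Nat.lt_pow_self (by omega)
  have h4 : k + 2 ≤ 2 * (2 * b + 1) ^ k := by omega
  -- The growth factor `2 * b + 1` exceeds the `3 * b / 2` that the second summand uses up by
  -- `(b + 2) / 2`, which has to absorb the first summand.
  have h5 : 8 * b < (b + 2) * (2 * b + 1) := by nlinarith [sq_nonneg ((b : ℤ) - 1)]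
  have h6 : 2 * (e * b) < (b + 2) * (2 * b + 1) ^ (k + 1) := by
    calc 2 * (e * b) ≤ 2 * ((2 * (k + 2)) * b) := by
          refine Nat.mul_le_mul_left _ (Nat.mul_le_mul_right _ (by omega))
      _ ≤ 2 * ((2 * (2 * (2 * b + 1) ^ k)) * b) := by
          refine Nat.mul_le_mul_left _ (Nat.mul_le_mul_right _ (by omega))
      _ = (8 * b) * (2 * b + 1) ^ k := by ring
      _ < ((b + 2) * (2 * b + 1)) * (2 * b + 1) ^ k :=
          Nat.mul_lt_mul_of_pos_right h5 (by positivity)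
      _ = _ := by ring
  have h7 := Nat.mul_lt_mul_of_pos_right h6 (scaledChoose_pos (a := a) (b := b) (e := e / 2))
  have h8 := Nat.mul_le_mul_left (b + 2) h1
  nlinarith

theorem mul_scaledChoose_sub_le {a b e f : ℕ} (ha : 0 < a) (hb : 0 < b) (hf : 0 < f)
    (hfe : f < e) :
    f * scaledChoose a b (e - f) ≤ scaledChoose a b (e - 1) := by
  have h1 := pow_mul_scaledChoose_le ha hb (show 0 < e - f by omega) (f - 1)
  rw [show e - f + (f - 1) = e - 1 by omega] at h1
  refine le_trans (Nat.mul_le_mul_right _ ?_) h1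
  have : f - 1 < (2 * b + 1) ^ (f - 1) := Nat.lt_pow_self (by omega)
  omega

end Growth

/-! ### Comparing two groups -/

section Comparison

theorem numOfOrder_one {G : Type*} [AddCommGroup G] : numOfOrder G 1 = 1 := by
  simp [numOfOrder]

/-- The weight at a divisor `i > d` coprime to `d` is small compared with that at the scaling factor
`g / d - 1`: with `w = g / (d * i)`, the scaling factors `g / d = i * w` and `g / i = d * w` are at
distance `(i - d) * w`, and each unit of distance costs a constant factor. -/
theorem mul_scaledChoose_div_le {a b g d i : ℕ} (ha : 0 < a) (hb : 0 < b) (hg : 0 < g) (hd : 2 ≤ d)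
    (hdi : d < i) (hcop : i.Coprime d) (hdg : d ∣ g) (hig : i ∣ g) :
    2 * (g / d) * scaledChoose a b (g / i) ≤ 3 * d * scaledChoose a b (g / d - 1) := by
  obtain ⟨w, rfl⟩ := hcop.mul_dvd_of_dvd_of_dvd hig hdg
  have hw : 0 < w := Nat.pos_of_ne_zero fun h => by simp [h] at hg
  obtain ⟨x, rfl⟩ := Nat.exists_eq_add_of_lt hdi
  have e1 : (d + x + 1) * d * w / d = (d + x + 1) * w := by
    rw [mul_right_comm, Nat.mul_div_cancel _ (by omega)]
  have e2 : (d + x + 1) * d * w / (d + x + 1) = d * w := by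
    rw [mul_assoc, Nat.mul_div_cancel_left _ (by omega)]
  rw [e1, e2]
  have e3 : (d + x + 1) * w - (x + 1) * w = d * w := by
    rw [← Nat.sub_mul]; congr 1; omega
  have h := mul_scaledChoose_sub_le ha hb (f := (x + 1) * w) (e := (d + x + 1) * w)
    (by positivity) (Nat.mul_lt_mul_of_pos_right (by omega) hw)
  rw [e3] at h
  have h2 : 2 * (d + x + 1) ≤ 3 * d * (x + 1) := by nlinarith
  calc 2 * ((d + x + 1) * w) * scaledChoose a b (d * w)
      = 2 * (d + x + 1) * (w * scaledChoose a b (d * w)) := by ring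
    _ ≤ 3 * d * (x + 1) * (w * scaledChoose a b (d * w)) := Nat.mul_le_mul_right _ h2
    _ = 3 * d * ((x + 1) * w * scaledChoose a b (d * w)) := by ring
    _ ≤ _ := Nat.mul_le_mul_left _ h

/-- The least index `d` at which two functions differ is a prime power if the functions are
multiplicative, and any further such index below `2 * d` is coprime to `d`. -/
theorem exists_prime_pow_and_coprime {φ ψ : ℕ → ℕ} {g d : ℕ} (hd : d ∣ g) (hg : 0 < g)
    (h1 : φ 1 = ψ 1)
    (hφ : ∀ u v, u.Coprime v → 0 < u → 0 < v → φ (u * v) = φ u * φ v)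
    (hψ : ∀ u v, u.Coprime v → 0 < u → 0 < v → ψ (u * v) = ψ u * ψ v)
    (hmin : ∀ i, i ∣ g → i < d → φ i = ψ i) (hne : φ d ≠ ψ d) :
    ∃ p k, p.Prime ∧ d = p ^ k ∧ 2 ≤ d ∧
      ∀ i, i ∣ g → φ i ≠ ψ i → i < 2 * d → i ≠ d → i.Coprime d := by
  have key : ∀ u v, u.Coprime v → u * v ∣ g → u < d → v < d → φ (u * v) = ψ (u * v) := by
    intro u v huv huvg hu hv
    have hu0 : 0 < u := Nat.pos_of_dvd_of_pos ((Dvd.intro _ rfl).trans huvg) hg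
    have hv0 : 0 < v := Nat.pos_of_dvd_of_pos ((Dvd.intro_left _ rfl).trans huvg) hg
    rw [hφ u v huv hu0 hv0, hψ u v huv hu0 hv0, hmin u ((Dvd.intro _ rfl).trans huvg) hu,
      hmin v ((Dvd.intro_left _ rfl).trans huvg) hv]
  have hd0 : 0 < d := Nat.pos_of_dvd_of_pos hd hg
  have hd1 : d ≠ 1 := by rintro rfl; exact hne h1
  have hd2 : 2 ≤ d := by omega
  -- An index of disagreement below `2 * d` has only one prime factor.
  have hpp : ∀ i p, p.Prime → p ∣ i → i ∣ g → φ i ≠ ψ i → i < 2 * d →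
      i = p ^ i.factorization p := by
    intro i p hp hpi hig hi hlt
    have hi0 : i ≠ 0 := (Nat.pos_of_dvd_of_pos hig hg).ne'
    have hmul := Nat.ordProj_mul_ordCompl_eq_self i p
    have hcop : (p ^ i.factorization p).Coprime (i / p ^ i.factorization p) :=
      Nat.Coprime.pow_left _ (Nat.coprime_ordCompl hp hi0)
    have hu : 2 ≤ p ^ i.factorization p :=
      hp.two_le.trans (Nat.le_self_pow (hp.factorization_pos_of_dvd hi0 hpi).ne' p)
    by_contra hcon
    have hv : 2 ≤ i / p ^ i.factorization p := by
      have h3 : i / p ^ i.factorization p ≠ 0 := (Nat.ordCompl_pos p hi0).ne'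
      have h4 : i / p ^ i.factorization p ≠ 1 := fun h =>
        hcon (by rw [h, mul_one] at hmul; exact hmul.symm)
      generalize i / p ^ i.factorization p = v at *
      omega
    refine hi ?_
    generalize p ^ i.factorization p = u at *
    generalize i / u = v at *
    subst hmul
    exact key _ _ hcop hig (by nlinarith) (by nlinarith)
  obtain ⟨p, hp, hpd⟩ := Nat.exists_prime_and_dvd hd1
  have hdp := hpp d p hp hpd hd hne (by omega)
  refine ⟨p, d.factorization p, hp, hdp, hd2, ?_⟩
  intro i hig hi hlt hid
  rw [hdp]
  refine Nat.Coprime.pow_right _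
    (Nat.Coprime.symm ((Nat.Prime.coprime_iff_not_dvd hp).2 fun hpi => ?_))
  have hip := hpp i p hp hpi hig hi hlt
  have hdi : d < i := lt_of_le_of_ne (not_lt.1 fun h => hi (hmin i hig h)) (Ne.symm hid)
  rw [hip, hdp] at hdi hlt
  have h5 := (Nat.pow_lt_pow_iff_right hp.one_lt).1 hdi
  have h6 := Nat.pow_le_pow_right hp.pos h5
  rw [pow_succ] at h6
  have := hp.two_le
  nlinarith

/-- If the first disagreement between the order statistics of `G` and `H` is in favour of `G`, then
the weighted sum of `G` is larger: the weight at `d` dominates all that comes after it. -/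
theorem sum_numOfOrder_mul_choose_lt {G H : Type*} [AddCommGroup G] [Finite G] [AddCommGroup H]
    [Finite H] {d : ℕ} (hd : d ∣ Nat.gcd (Nat.card G) (Nat.card H))
    (hmin : ∀ i, i ∣ Nat.gcd (Nat.card G) (Nat.card H) → i < d → numOfOrder G i = numOfOrder H i)
    (hlt : numOfOrder H d < numOfOrder G d) :
    ∑ i ∈ (Nat.gcd (Nat.card G) (Nat.card H)).divisors, numOfOrder H i *
        ((Nat.card G + Nat.card H) / i).choose (Nat.card G / i) <
      ∑ i ∈ (Nat.gcd (Nat.card G) (Nat.card H)).divisors, numOfOrder G i *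
        ((Nat.card G + Nat.card H) / i).choose (Nat.card G / i) := by
  have hn : 0 < Nat.card G := Nat.card_pos
  have hm : 0 < Nat.card H := Nat.card_pos
  set g := Nat.gcd (Nat.card G) (Nat.card H) with hgdef
  have hg : 0 < g := Nat.gcd_pos_of_pos_left _ hn
  obtain ⟨a, ha⟩ : g ∣ Nat.card G := Nat.gcd_dvd_left _ _
  obtain ⟨b, hb⟩ : g ∣ Nat.card H := Nat.gcd_dvd_right _ _
  have ha0 : 0 < a := Nat.pos_of_ne_zero fun h => hn.ne' (by rw [ha, h, mul_zero])
  have hb0 : 0 < b := Nat.pos_of_ne_zero fun h => hm.ne' (by rw [hb, h, mul_zero])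
  have hW : ∀ i ∈ g.divisors, ((Nat.card G + Nat.card H) / i).choose (Nat.card G / i) =
      scaledChoose a b (g / i) := by
    intro i hi
    obtain ⟨c, hc⟩ := Nat.dvd_of_mem_divisors hi
    have hi0 : 0 < i := Nat.pos_of_mem_divisors hi
    rw [scaledChoose, ha, hb, ← mul_add, hc, mul_assoc, mul_assoc, Nat.mul_div_cancel_left _ hi0,
      Nat.mul_div_cancel_left _ hi0, Nat.mul_div_cancel_left _ hi0]
  have hsum : ∀ φ : ℕ → ℕ, ∑ i ∈ g.divisors, φ i *
      ((Nat.card G + Nat.card H) / i).choose (Nat.card G / i) =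
        ∑ i ∈ g.divisors, φ i * scaledChoose a b (g / i) :=
    fun φ => Finset.sum_congr rfl fun i hi => by rw [hW i hi]
  rw [hsum, hsum]
  obtain ⟨p, k, hp, hdp, hd2, hcop⟩ := exists_prime_pow_and_coprime hd hg
    (numOfOrder_one.trans numOfOrder_one.symm)
    (fun u v huv hu hv => numOfOrder_mul_of_coprime (G := G) huv hu hv)
    (fun u v huv hu hv => numOfOrder_mul_of_coprime (G := H) huv hu hv) hmin hlt.ne'
  have hd0 : 0 < d := by omega
  -- The difference at `d` is a positive multiple of `d`.
  have hTG : d ∣ {x : G | d • x = 0}.ncard := by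
    rw [hdp] at hd ⊢
    exact pow_dvd_ncard_nsmul_eq_zero hp (hd.trans (Nat.gcd_dvd_left _ _))
  have hTH : d ∣ {x : H | d • x = 0}.ncard := by
    rw [hdp] at hd ⊢
    exact pow_dvd_ncard_nsmul_eq_zero hp (hd.trans (Nat.gcd_dvd_right _ _))
  have hTpos : d ≤ {x : H | d • x = 0}.ncard :=
    Nat.le_of_dvd ((Set.ncard_pos (Set.toFinite _)).2 ⟨0, smul_zero _⟩) hTH
  have hgap : d + numOfOrder H d ≤ numOfOrder G d := by
    rw [← sum_numOfOrder_divisors hd0, ← Nat.insert_self_properDivisors hd0.ne',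
      Finset.sum_insert Nat.self_notMem_properDivisors] at hTG hTH
    have heq : ∑ i ∈ d.properDivisors, numOfOrder G i =
        ∑ i ∈ d.properDivisors, numOfOrder H i := by
      refine Finset.sum_congr rfl fun i hi => ?_
      rw [Nat.mem_properDivisors] at hi
      exact hmin i (hi.1.trans hd) hi.2
    rw [heq] at hTG
    have h1 := Nat.dvd_sub hTG hTH
    rw [Nat.add_sub_add_right] at h1
    have h2 := Nat.le_of_dvd (by omega) h1
    omega
  set D := g.divisors.filter fun i => numOfOrder G i ≠ numOfOrder H i ∧ i ≠ d with hD
  have hDspec : ∀ i ∈ D, i ∣ g ∧ d < i ∧ numOfOrder G i ≠ numOfOrder H i := by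
    intro i hi
    obtain ⟨h1, h2, h3⟩ := Finset.mem_filter.1 hi
    have hig := Nat.dvd_of_mem_divisors h1
    exact ⟨hig, lt_of_le_of_ne (not_lt.1 fun h => h2 (hmin i hig h)) (Ne.symm h3), h2⟩
  set e := g / d with he
  have hge : g = d * e := (Nat.mul_div_cancel' hd).symm
  have he0 : 0 < e := Nat.div_pos (Nat.le_of_dvd hg hd) hd0
  have hcard : Nat.card H = d * (e * b) := by rw [hb, hge, mul_assoc]
  have hreduce : ∑ i ∈ g.divisors, numOfOrder H i * scaledChoose a b (g / i) +
      d * scaledChoose a b e ≤ ∑ i ∈ g.divisors, numOfOrder G i * scaledChoose a b (g / i) +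
        ∑ i ∈ D, numOfOrder H i * scaledChoose a b (g / i) := by
    have h1 : d * scaledChoose a b e =
        ∑ i ∈ g.divisors, if i = d then d * scaledChoose a b e else 0 := by
      rw [Finset.sum_ite_eq', if_pos (Nat.mem_divisors.2 ⟨hd, hg.ne'⟩)]
    rw [h1, hD, Finset.sum_filter, ← Finset.sum_add_distrib, ← Finset.sum_add_distrib]
    refine Finset.sum_le_sum fun i hi => ?_
    by_cases hid : i = d
    · subst hid
      have := Nat.mul_le_mul_right (scaledChoose a b e) hgap
      simp only [if_true, ne_eq, not_true, and_false, if_false]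
      linarith
    · by_cases hi' : numOfOrder G i = numOfOrder H i
      · simp [hid, hi']
      · simp [hid, hi']
  suffices hmain : ∑ i ∈ D, numOfOrder H i * scaledChoose a b (g / i) < d * scaledChoose a b e by
    linarith
  rw [← Finset.sum_filter_add_sum_filter_not D (fun i => 2 * d ≤ i)]
  -- Indices from `2 * d` on, by the trivial bound `|H|` for the number of elements.
  have hA : ∑ i ∈ D.filter (fun i => 2 * d ≤ i), numOfOrder H i * scaledChoose a b (g / i) ≤
      d * (e * b * scaledChoose a b (e / 2)) := by
    have h1 : ∑ i ∈ D.filter (fun i => 2 * d ≤ i), numOfOrder H i ≤ Nat.card H := by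
      rw [sum_numOfOrder_eq_ncard, ← Set.ncard_univ]
      exact Set.ncard_le_ncard (Set.subset_univ _)
    calc _ ≤ ∑ i ∈ D.filter (fun i => 2 * d ≤ i), numOfOrder H i * scaledChoose a b (e / 2) := by
          refine Finset.sum_le_sum fun i hi => Nat.mul_le_mul_left _ (scaledChoose_mono ha0 hb0 ?_)
          rw [he, Nat.div_div_eq_div_mul, mul_comm d 2]
          exact Nat.div_le_div_left (Finset.mem_filter.1 hi).2 (by omega)
      _ ≤ Nat.card H * scaledChoose a b (e / 2) := by
          rw [← Finset.sum_mul]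
          exact Nat.mul_le_mul_right _ h1
      _ = _ := by rw [hcard]; ring
  -- Indices below `2 * d` are coprime to `d`, so `H` has at most `|H| / d` elements of such orders.
  set B := D.filter fun i => ¬ 2 * d ≤ i with hB
  have hBspec : ∀ i ∈ B, i ∣ g ∧ d < i ∧ i.Coprime d := by
    intro i hi
    obtain ⟨h1, h2⟩ := Finset.mem_filter.1 hi
    obtain ⟨h3, h4, h5⟩ := hDspec i h1
    exact ⟨h3, h4, hcop i h3 h5 (not_le.1 h2) h4.ne'⟩
  rcases B.eq_empty_or_nonempty with hBe | ⟨j, hj⟩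
  · rw [hBe, Finset.sum_empty, add_zero]
    exact hA.trans_lt (Nat.mul_lt_mul_of_pos_left (mul_scaledChoose_half_lt ha0 hb0 he0) hd0)
  · have he3 : 3 ≤ e := by
      obtain ⟨h1, h2, h3⟩ := hBspec j hj
      have h4 : j ∣ e := by
        rw [hge] at h1
        exact h3.dvd_of_dvd_mul_left h1
      have := Nat.le_of_dvd he0 h4
      omega
    have hBcard : ∑ i ∈ B, numOfOrder H i ≤ e * b := by
      refine Nat.le_of_mul_le_mul_left (c := d) ?_ hd0
      rw [← hcard, sum_numOfOrder_eq_ncard]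
      refine le_trans (Nat.mul_le_mul hTpos (Set.ncard_le_ncard ?_))
        (ncard_nsmul_eq_zero_mul_ncard_coprime_le d)
      exact fun x hx => (hBspec _ hx).2.2
    have hBsum : 2 * ∑ i ∈ B, numOfOrder H i * scaledChoose a b (g / i) ≤
        d * (3 * b * scaledChoose a b (e - 1)) := by
      refine Nat.le_of_mul_le_mul_left (c := e) ?_ he0
      calc e * (2 * ∑ i ∈ B, numOfOrder H i * scaledChoose a b (g / i))
          = ∑ i ∈ B, numOfOrder H i * (2 * e * scaledChoose a b (g / i)) := by
            rw [← mul_assoc, Finset.mul_sum]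
            exact Finset.sum_congr rfl fun i _ => by ring
        _ ≤ ∑ i ∈ B, numOfOrder H i * (3 * d * scaledChoose a b (e - 1)) := by
            refine Finset.sum_le_sum fun i hi => Nat.mul_le_mul_left _ ?_
            obtain ⟨h1, h2, h3⟩ := hBspec i hi
            exact mul_scaledChoose_div_le ha0 hb0 hg hd2 h2 h3 hd h1
        _ ≤ (e * b) * (3 * d * scaledChoose a b (e - 1)) := by
            rw [← Finset.sum_mul]
            exact Nat.mul_le_mul_right _ hBcard
        _ = _ := by ring
    have h := Nat.mul_lt_mul_of_pos_left (mul_scaledChoose_half_add_lt ha0 hb0 he3) hd0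
    rw [mul_add] at h
    linarith

end Comparison

theorem theorem1p1 {G : Type*} {H : Type*} [AddCommGroup G] [Finite G]
    [AddCommGroup H] [Finite H] :
    (zeroSumSequences G (Nat.card H)).ncard = (zeroSumSequences H (Nat.card G)).ncard ↔
      ∀ d : ℕ, d ∣ Nat.gcd (Nat.card G) (Nat.card H) → numOfOrder G d = numOfOrder H d := by
  have hn : 0 < Nat.card G := Nat.card_pos
  have hG := add_mul_ncard_zeroSumSequences (G := G) (Nat.card H)
  have hH := add_mul_ncard_zeroSumSequences (G := H) (Nat.card G)
  have hsymm : ∀ i ∈ (Nat.gcd (Nat.card G) (Nat.card H)).divisors,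
      ((Nat.card G + Nat.card H) / i).choose (Nat.card H / i) =
        ((Nat.card G + Nat.card H) / i).choose (Nat.card G / i) := by
    intro i hi
    rw [Nat.add_div_of_dvd_right ((Nat.dvd_of_mem_divisors hi).trans (Nat.gcd_dvd_left _ _)),
      Nat.choose_symm_add]
  have hswap : ∀ φ : ℕ → ℕ, ∑ i ∈ (Nat.gcd (Nat.card H) (Nat.card G)).divisors, φ i *
      ((Nat.card H + Nat.card G) / i).choose (Nat.card H / i) =
        ∑ i ∈ (Nat.gcd (Nat.card G) (Nat.card H)).divisors, φ i *
          ((Nat.card G + Nat.card H) / i).choose (Nat.card G / i) := by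
    intro φ
    rw [Nat.gcd_comm, add_comm (Nat.card H)]
    exact Finset.sum_congr rfl fun i hi => by rw [hsymm i hi]
  rw [hswap, add_comm (Nat.card H)] at hH
  constructor
  · intro heq
    rw [heq, hH] at hG
    by_contra! hcon
    classical
    obtain ⟨hd, hne⟩ := Nat.find_spec hcon
    have hmin : ∀ i, i ∣ Nat.gcd (Nat.card G) (Nat.card H) → i < Nat.find hcon →
        numOfOrder G i = numOfOrder H i := by
      intro i hi hlt
      by_contra h
      exact Nat.find_min hcon hlt ⟨hi, h⟩
    rcases lt_or_gt_of_ne hne with hlt | hlt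
    · have h := sum_numOfOrder_mul_choose_lt (G := H) (H := G) (hd.trans (Nat.gcd_comm _ _).dvd)
        (fun i hi hid => (hmin i (hi.trans (Nat.gcd_comm _ _).dvd) hid).symm) hlt
      rw [hswap, hswap] at h
      exact h.ne' hG
    · exact (sum_numOfOrder_mul_choose_lt hd hmin hlt).ne hG
  · intro h
    refine Nat.eq_of_mul_eq_mul_left (Nat.add_pos_left hn (Nat.card H)) ?_
    rw [hG, hH]
    exact Finset.sum_congr rfl fun i hi => by rw [h i (Nat.dvd_of_mem_divisors hi)]
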